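/- For $d \ge 1$ and a finite-dimensional complex vector space $V$, let $S^dV$ be the space of homogeneous polynomials of degree $d$ on $V^*$. For $P \in S^dV$ let the symmetric rank $R_s(P)$ be the least $r \in \mathbb{N}$ such that $P = \sum_{i=1}^r v_i^d$ for some $v_1,\dots,v_r \in V$, and let the symmetric border rank be $$\underline{R}_s(P) = \min\{ r \in \mathbb{N} : P \in \overline{\{T \in S^dV : R_s(T) = r\}} \},$$ where the overline denotes the Zariski closure in $S^dV$. Let $\det_3, \operatorname{perm}_3 \in S^3\mathbb{C}^9$ be the determinant and the permanent of the $3\times 3$ matrix whose entries are the nine coordinate variables. Then $$\underline{R}_s(\det\nolimits_3) \ge 14 \qquad\text{and}\qquad \underline{R}_s(\operatorname{perm}_3) \ge 14.$$ -/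

import Mathlib

/-- The linear form `∑ j, v j • X j` with coefficient vector `v`. -/
noncomputable def linForm {σ : Type*} [Fintype σ] (v : σ → ℂ) : MvPolynomial σ ℂ :=
  ∑ j, MvPolynomial.C (v j) * MvPolynomial.X j

/-- `P` is a sum of `r` many `d`-th powers of linear forms. -/
def IsSumOfPowers {σ : Type*} [Fintype σ] {d : ℕ}
    (P : MvPolynomial.homogeneousSubmodule σ ℂ d) (r : ℕ) : Prop :=
  ∃ v : Fin r → σ → ℂ, (P : MvPolynomial σ ℂ) = ∑ i, linForm (v i) ^ d

/-- The symmetric (Waring) rank of a form of degree `d`: the least `r` such that the form is a sum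
of `r` many `d`-th powers of linear forms (`⊤` if there is no such `r`, which can happen only for
`d = 0`). -/
noncomputable def symRank {σ : Type*} [Fintype σ] {d : ℕ}
    (P : MvPolynomial.homogeneousSubmodule σ ℂ d) : ℕ∞ :=
  ⨅ (r : ℕ) (_ : IsSumOfPowers P r), (r : ℕ∞)

/-- The Zariski closure of a subset `S` of a complex vector space `W`: the common zeros of all
polynomial functions on `W` (polynomials in linear functionals on `W`) that vanish on `S`. -/
def zariskiClosure {W : Type*} [AddCommGroup W] [Module ℂ W] (S : Set W) : Set W :=
  {w | ∀ f : MvPolynomial (Module.Dual ℂ W) ℂ,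
    (∀ s ∈ S, MvPolynomial.eval (fun φ : Module.Dual ℂ W => φ s) f = 0) →
      MvPolynomial.eval (fun φ : Module.Dual ℂ W => φ w) f = 0}

/-- The symmetric border rank of a form `P` of degree `d`: the least natural number `r` such that
`P` lies in the Zariski closure, inside the space of all forms of degree `d`, of the set of forms
of symmetric rank `r`. -/
noncomputable def symBorderRank {σ : Type*} [Fintype σ] {d : ℕ}
    (P : MvPolynomial.homogeneousSubmodule σ ℂ d) : ℕ :=
  sInf {r : ℕ | P ∈ zariskiClosure
    {T : MvPolynomial.homogeneousSubmodule σ ℂ d | symRank T = (r : ℕ∞)}}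

theorem isHomogeneous_prod_X {n : ℕ} (s : Equiv.Perm (Fin n)) :
    (∏ i, Matrix.mvPolynomialX (Fin n) (Fin n) ℂ (s i) i).IsHomogeneous n := by
  have h := MvPolynomial.IsHomogeneous.prod Finset.univ
    (fun i => Matrix.mvPolynomialX (Fin n) (Fin n) ℂ (s i) i) (fun _ => 1)
    (fun i _ => by
      simpa [Matrix.mvPolynomialX_apply] using MvPolynomial.isHomogeneous_X ℂ (s i, i))
  simpa using h

theorem isHomogeneous_det (n : ℕ) :
    (Matrix.mvPolynomialX (Fin n) (Fin n) ℂ).det.IsHomogeneous n := by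
  rw [Matrix.det_apply]
  refine MvPolynomial.IsHomogeneous.sum _ _ _ fun s _ => ?_
  have h : ∀ u : ℤˣ, (u • ∏ i, Matrix.mvPolynomialX (Fin n) (Fin n) ℂ (s i) i).IsHomogeneous n := by
    intro u
    rcases Int.units_eq_one_or u with rfl | rfl
    · simpa using isHomogeneous_prod_X s
    · simpa using (isHomogeneous_prod_X s).neg
  exact h _

theorem isHomogeneous_permanent (n : ℕ) :
    (Matrix.mvPolynomialX (Fin n) (Fin n) ℂ).permanent.IsHomogeneous n :=
  MvPolynomial.IsHomogeneous.sum _ _ _ fun s _ => isHomogeneous_prod_X s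

/-- The determinant of the generic `n × n` matrix, as a form of degree `n` in `n²` variables. -/
noncomputable def detForm (n : ℕ) : MvPolynomial.homogeneousSubmodule (Fin n × Fin n) ℂ n :=
  ⟨(Matrix.mvPolynomialX (Fin n) (Fin n) ℂ).det, isHomogeneous_det n⟩

/-- The permanent of the generic `n × n` matrix, as a form of degree `n` in `n²` variables. -/
noncomputable def permForm (n : ℕ) : MvPolynomial.homogeneousSubmodule (Fin n × Fin n) ℂ n :=
  ⟨(Matrix.mvPolynomialX (Fin n) (Fin n) ℂ).permanent, isHomogeneous_permanent n⟩

/-! The bound comes from a Koszul flattening. Five vectors `w m` define a map from `V` to a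
five-dimensional space `U`, and each cubic `T` yields a matrix, linear in `T`, of a map `V* ⊗ ⋀²U →
V ⊗ ⋀³U`. For a cube `v³` with image `u` in `U`, this map factors through wedging `⋀²U` with `u`.
That has rank at most `6`, since `u ∧ U` is killed. Hence a sum of `r` cubes has flattening rank at
most `6 r`. Vanishing of minors is a Zariski closed condition, so the bound passes to border rank:
`card_le_symBorderRank_mul`.

For the determinant and the permanent, the `w m` are indicators of disjoint sets of matrix
positions. Each flattening entry is then at most one signed term, so both cubics have the same zero
pattern. `koszulPivots` selects an `80 × 80` triangular minor with nonzero diagonal, and `80 > 13 *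
6`. -/

open MvPolynomial

/-! ### Subadditivity of matrix rank. -/

namespace Matrix

theorem rank_add_le_add {m n K : Type*} [Fintype m] [Fintype n] [Field K] (A B : Matrix m n K) :
    (A + B).rank ≤ A.rank + B.rank := by
  have h : LinearMap.range (A + B).mulVecLin ≤
      LinearMap.range A.mulVecLin ⊔ LinearMap.range B.mulVecLin := by
    rw [mulVecLin_add]
    exact LinearMap.range_add_le _ _
  exact (Submodule.finrank_mono h).trans (Submodule.finrank_add_le_finrank_add_finrank _ _)

theorem rank_sum_le_card_mul {ι m n K : Type*} [Fintype m] [Fintype n] [Field K] (s : Finset ι)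
    (A : ι → Matrix m n K) (k : ℕ) (h : ∀ i ∈ s, (A i).rank ≤ k) :
    (∑ i ∈ s, A i).rank ≤ s.card * k := by
  classical
  induction s using Finset.induction_on with
  | empty => simp
  | insert a s ha ih =>
    rw [Finset.sum_insert ha]
    refine (rank_add_le_add _ _).trans ((add_le_add (h a (Finset.mem_insert_self a s))
      (ih fun i hi => h i (Finset.mem_insert_of_mem hi))).trans_eq ?_)
    rw [Finset.card_insert_of_notMem ha]
    ring

theorem det_eq_zero_of_rank_lt {n K : Type*} [Fintype n] [DecidableEq n] [Field K]
    {A : Matrix n n K} (h : A.rank < Fintype.card n) : A.det = 0 := by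
  by_contra hA
  exact h.ne (rank_of_isUnit A ((isUnit_iff_isUnit_det A).2 (isUnit_iff_ne_zero.2 hA)))

end Matrix

/-! ### Lower bounds on border rank from minors. -/

section BorderRank

variable {σ : Type*} [Fintype σ] {d : ℕ}

theorem isHomogeneous_linForm (v : σ → ℂ) : (linForm v).IsHomogeneous 1 :=
  IsHomogeneous.sum _ _ _ fun j _ => by
    simpa using (isHomogeneous_C σ (v j)).mul (isHomogeneous_X ℂ j)

/-- The `d`-th power of a linear form, as a form of degree `d`. -/
noncomputable def linPow (d : ℕ) (v : σ → ℂ) : homogeneousSubmodule σ ℂ d :=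
  ⟨linForm v ^ d, by simpa using (isHomogeneous_linForm v).pow d⟩

/-- Having at most `r` summands is enough for rank bounds, so whether the infimum is attained need
not be settled. -/
theorem exists_isSumOfPowers_of_symRank_eq {T : homogeneousSubmodule σ ℂ d} {r : ℕ}
    (h : symRank T = r) : ∃ r' ≤ r, IsSumOfPowers T r' := by
  by_contra! hT
  have : ((r + 1 : ℕ) : ℕ∞) ≤ symRank T := by
    refine le_iInf₂ fun r' hr' => ?_
    exact_mod_cast not_le.1 fun hle => hT r' hle hr'
  rw [h] at this
  exact absurd (Nat.cast_le.1 this) (by simp)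

theorem symRank_ne_top_of_isSumOfPowers {T : homogeneousSubmodule σ ℂ d} {r : ℕ}
    (h : IsSumOfPowers T r) : symRank T ≠ ⊤ :=
  ((iInf₂_le r h).trans_lt (ENat.natCast_lt_top r)).ne

theorem subset_zariskiClosure {W : Type*} [AddCommGroup W] [Module ℂ W] (S : Set W) :
    S ⊆ zariskiClosure S :=
  fun w hw _ hf => hf w hw

/-- A matrix of linear functionals whose rank is at most `k` on the `d`-th powers of linear forms
and which is invertible at `P` bounds the symmetric border rank of `P` from below. -/
theorem card_le_symBorderRank_mul {n : Type*} [Fintype n] [DecidableEq n]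
    (Φ : n → n → Module.Dual ℂ (homogeneousSubmodule σ ℂ d)) (k : ℕ)
    (hΦ : ∀ v, (Matrix.of fun i j => Φ i j (linPow d v)).rank ≤ k)
    {P : homogeneousSubmodule σ ℂ d} (hP : (Matrix.of fun i j => Φ i j P).det ≠ 0)
    (hfin : ∃ r, IsSumOfPowers P r) :
    Fintype.card n ≤ symBorderRank P * k := by
  -- `sInf ∅ = 0` in `ℕ`, so the lower bound needs this set to be nonempty; this is the use of
  -- `hfin`.
  have hne : {r : ℕ | P ∈ zariskiClosure
      {T : homogeneousSubmodule σ ℂ d | symRank T = (r : ℕ∞)}}.Nonempty := by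
    obtain ⟨r, hr⟩ := hfin
    obtain ⟨q, hq⟩ := ENat.ne_top_iff_exists.1 (symRank_ne_top_of_isSumOfPowers hr)
    exact ⟨q, subset_zariskiClosure _ hq.symm⟩
  have hmem : P ∈ zariskiClosure
      {T : homogeneousSubmodule σ ℂ d | symRank T = (symBorderRank P : ℕ∞)} := Nat.sInf_mem hne
  by_contra! hlt
  -- The minor is a polynomial in linear functionals, hence an admissible test function for
  -- `zariskiClosure`.
  have heval : ∀ T : homogeneousSubmodule σ ℂ d,
      eval (fun φ : Module.Dual ℂ (homogeneousSubmodule σ ℂ d) => φ T)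
        (Matrix.of fun i j => (X (Φ i j) : MvPolynomial _ ℂ)).det =
      (Matrix.of fun i j => Φ i j T).det := by
    intro T
    rw [RingHom.map_det]
    congr 1
    ext i j
    simp
  refine hP ?_
  rw [← heval]
  refine hmem _ fun T hT => ?_
  rw [heval]
  obtain ⟨r, hr, v, hv⟩ := exists_isSumOfPowers_of_symRank_eq hT
  have hT' : T = ∑ i, linPow d (v i) := Subtype.ext (by simp [hv, linPow])
  have hsum : (Matrix.of fun i j => Φ i j T) =
      ∑ s, Matrix.of fun i j => Φ i j (linPow d (v s)) := by
    ext i j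
    simp [hT', Matrix.sum_apply]
  refine Matrix.det_eq_zero_of_rank_lt (lt_of_le_of_lt ?_ hlt)
  rw [hsum]
  refine (Matrix.rank_sum_le_card_mul _ _ k fun s _ => hΦ _).trans ?_
  simpa using Nat.mul_le_mul_right k hr

end BorderRank

/-! ### Existence of Waring decompositions. -/

section Waring

variable {σ : Type*} [Fintype σ]

theorem exists_isSumOfPowers_iff {d : ℕ} {P : homogeneousSubmodule σ ℂ d} :
    (∃ r, IsSumOfPowers P r) ↔
      (P : MvPolynomial σ ℂ) ∈ AddSubmonoid.closure (Set.range fun v : σ → ℂ => linForm v ^ d) := by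
  constructor
  · rintro ⟨r, v, hv⟩
    rw [hv]
    exact sum_mem fun i _ => AddSubmonoid.subset_closure ⟨v i, rfl⟩
  · intro h
    obtain ⟨l, hl, hsum⟩ := AddSubmonoid.exists_list_of_mem_closure h
    choose! w hw using hl
    refine ⟨l.length, fun i => w l[i], ?_⟩
    rw [← hsum]
    conv_lhs => rw [← List.ofFn_getElem (xs := l)]
    rw [List.sum_ofFn]
    exact Finset.sum_congr rfl fun i _ => (hw _ (List.getElem_mem _)).symm

theorem linForm_add (v w : σ → ℂ) : linForm (v + w) = linForm v + linForm w := by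
  simp [linForm, add_mul, Finset.sum_add_distrib]

theorem linForm_smul (t : ℂ) (v : σ → ℂ) : linForm (t • v) = C t * linForm v := by
  simp [linForm, Finset.mul_sum, mul_assoc]

theorem linForm_single [DecidableEq σ] (p : σ) : linForm (Pi.single p 1) = X p := by
  simp [linForm, Pi.single_apply]

/-- Summing `(a p + b q + a b r)³` over signs `a, b = ±1` cancels every monomial except `p q r`,
leaving `24 p q r`. The scalar is absorbed by a complex cube root of `t / 24`. -/
theorem C_mul_X_mul_X_mul_X_mem_closure (t : ℂ) (p q r : σ) :
    C t * (X p * X q * X r) ∈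
      AddSubmonoid.closure (Set.range fun v : σ → ℂ => linForm v ^ 3) := by
  classical
  obtain ⟨c, hc⟩ := IsAlgClosed.exists_pow_nat_eq (t / 24) (n := 3) (by norm_num)
  have key : ∀ a b : ℂ, (C c * (C a * X p + C b * X q + C (a * b) * X r)) ^ 3 ∈
      AddSubmonoid.closure (Set.range fun v : σ → ℂ => linForm v ^ 3) := fun a b =>
    AddSubmonoid.subset_closure
      ⟨c • (a • Pi.single p 1 + b • Pi.single q 1 + (a * b) • Pi.single r 1), by
        simp only [linForm_add, linForm_smul, linForm_single]⟩
  have h := add_mem (add_mem (key 1 1) (key (-1) (-1))) (add_mem (key (-1) 1) (key 1 (-1)))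
  have ht : (C t : MvPolynomial σ ℂ) = 24 * C c ^ 3 := by
    rw [← C_pow, hc, show (24 : MvPolynomial σ ℂ) = C 24 from (map_ofNat C 24).symm, ← C_mul]
    congr 1
    ring
  convert h using 1
  rw [ht]
  simp only [mul_one, mul_neg, neg_neg, C_neg, C_1]
  ring

end Waring

/-! ### Third partial derivatives as linear functionals on cubics. -/

section Polarization

variable {σ : Type*}

/-- The third-order partial derivative at the origin along the coordinates `a`, `b`, `c`. -/
noncomputable def thirdPartial (a b c : σ) : MvPolynomial σ ℂ →ₗ[ℂ] ℂ :=
  (aeval (0 : σ → ℂ)).toLinearMap ∘ₗ (pderiv a).toLinearMap ∘ₗ (pderiv b).toLinearMap ∘ₗ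
    (pderiv c).toLinearMap

theorem thirdPartial_apply (a b c : σ) (f : MvPolynomial σ ℂ) :
    thirdPartial a b c f = aeval (0 : σ → ℂ) (pderiv a (pderiv b (pderiv c f))) :=
  rfl

theorem pderiv_linForm [Fintype σ] (a : σ) (v : σ → ℂ) : pderiv a (linForm v) = C (v a) := by
  classical
  simp [linForm, pderiv_X, Pi.single_apply]

theorem thirdPartial_linForm_pow [Fintype σ] (a b c : σ) (v : σ → ℂ) :
    thirdPartial a b c (linForm v ^ 3) = 6 * (v a * v b * v c) := by
  simp [thirdPartial_apply, pow_succ, pderiv_linForm]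
  ring

/-- The third-order partial derivative of the monomial `X p * X q * X r` along `a`, `b`, `c`. -/
def monomialPartial [DecidableEq σ] (a b c p q r : σ) : ℤ :=
  let δ (i j : σ) : ℤ := if i = j then 1 else 0
  δ a p * (δ b q * δ c r + δ b r * δ c q) + δ a q * (δ b p * δ c r + δ b r * δ c p) +
    δ a r * (δ b p * δ c q + δ b q * δ c p)

theorem thirdPartial_X_mul_X_mul_X [DecidableEq σ] (a b c p q r : σ) :
    thirdPartial a b c (X p * X q * X r) = monomialPartial a b c p q r := by
  have hX : ∀ i j : σ, pderiv i (X j : MvPolynomial σ ℂ) = C (if i = j then 1 else 0) := by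
    intro i j
    rw [pderiv_X, Pi.single_apply]
    split_ifs with h₁ h₂ h₂ <;> simp_all
  simp only [thirdPartial_apply, pderiv_mul, hX, pderiv_C, map_add, map_mul, aeval_X, aeval_C,
    Pi.zero_apply, monomialPartial, Algebra.algebraMap_self, RingHom.id_apply, map_zero]
  push_cast
  ring

end Polarization

/-! ### The Koszul flattening and its rank on cubes. -/

section Koszul

/-- The sign of the map `0, 1, 2, 3, 4 ↦ i, j, m, k, l`, which is zero unless the map is
injective. -/
def altSign (i j m k l : Fin 5) : ℤ :=
  let s (a b : Fin 5) : ℤ := Int.sign ((b : ℤ) - a)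
  s i j * s i m * s i k * s i l * s j m * s j k * s j l * s m k * s m l * s k l

theorem altSign_swap_snd (i j m k l : Fin 5) : altSign i j m l k = -altSign i j m k l := by
  simp only [altSign]
  rw [← neg_sub (l : ℤ) k, Int.sign_neg]
  ring

theorem altSign_swap_mid (i j m k l : Fin 5) : altSign i j k m l = -altSign i j m k l := by
  simp only [altSign]
  rw [← neg_sub (k : ℤ) m, Int.sign_neg]
  ring

/-- An alternating family indexed by pairs from a five-element set which is annihilated by a
nonzero vector spans a space of dimension at most six. -/
theorem finrank_span_range_le_six {E : Type*} [AddCommGroup E] [Module ℂ E]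
    (c : Fin 5 → Fin 5 → E) (hc : ∀ k l, c l k = -c k l) (u : Fin 5 → ℂ) (hu : u ≠ 0)
    (h : ∀ l, ∑ m, u m • c m l = 0) :
    Module.finrank ℂ (Submodule.span ℂ (Set.range fun x : Fin 5 × Fin 5 => c x.1 x.2)) ≤ 6 := by
  classical
  obtain ⟨t, ht⟩ := Function.ne_iff.1 hu
  have hdiag : ∀ k, c k k = 0 := fun k => by
    have h2 : (2 : ℂ) • c k k = 0 := by
      rw [two_smul, add_eq_zero_iff_eq_neg]
      exact hc k k
    exact (smul_eq_zero.1 h2).resolve_left two_ne_zero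
  let S : Finset (Fin 5 × Fin 5) := {x | x.1 < x.2 ∧ x.1 ≠ t ∧ x.2 ≠ t}
  have hS : S.card = 6 := by
    have : ∀ t : Fin 5, (Finset.univ.filter fun x : Fin 5 × Fin 5 =>
        x.1 < x.2 ∧ x.1 ≠ t ∧ x.2 ≠ t).card = 6 := by decide
    exact this t
  let T : Finset E := S.image fun x => c x.1 x.2
  have hne : ∀ k l, k ≠ t → l ≠ t → c k l ∈ Submodule.span ℂ (T : Set E) := by
    intro k l hk hl
    rcases lt_trichotomy k l with hkl | rfl | hkl
    · exact Submodule.subset_span (Finset.mem_image.2 ⟨(k, l), by simp [S, *], rfl⟩)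
    · simp [hdiag]
    · rw [hc]
      exact Submodule.neg_mem _
        (Submodule.subset_span (Finset.mem_image.2 ⟨(l, k), by simp [S, *], rfl⟩))
  have ht' : ∀ l, c t l ∈ Submodule.span ℂ (T : Set E) := by
    intro l
    rcases eq_or_ne l t with rfl | hl
    · simp [hdiag]
    have hsum := h l
    rw [← Finset.add_sum_erase _ _ (Finset.mem_univ t), add_eq_zero_iff_eq_neg] at hsum
    -- As `u t ≠ 0`, the relation expresses `c t l` through pairs avoiding `t`; four remaining
    -- indices give six pairs.
    refine (Submodule.smul_mem_iff _ ht).1 ?_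
    rw [hsum]
    exact Submodule.neg_mem _ (Submodule.sum_mem _ fun m hm =>
      Submodule.smul_mem _ _ (hne m l (Finset.ne_of_mem_erase hm) hl))
  have hle : Submodule.span ℂ (Set.range fun x : Fin 5 × Fin 5 => c x.1 x.2) ≤
      Submodule.span ℂ (T : Set E) := by
    rw [Submodule.span_le]
    rintro _ ⟨⟨k, l⟩, rfl⟩
    by_cases hk : k = t
    · exact hk ▸ ht' l
    by_cases hl : l = t
    · have := Submodule.neg_mem _ (ht' k)
      rwa [← hc, ← hl] at this
    · exact hne k l hk hl
  exact (Submodule.finrank_mono hle).trans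
    ((finrank_span_finset_le_card T).trans (Finset.card_image_le.trans hS.le))

variable {σ : Type*} [Fintype σ]

/-- The entries of the Koszul flattening `V* ⊗ ⋀²U → V ⊗ ⋀³U` of a cubic form on `V*`, where
`U` is the five-dimensional quotient of `V` dual to the vectors `w m`, and `⋀³U ≃ (⋀²U)*`. -/
noncomputable def koszulEntry (w : Fin 5 → σ → ℂ) (x y : σ × Fin 5 × Fin 5) :
    Module.Dual ℂ (homogeneousSubmodule σ ℂ 3) :=
  (∑ m, (altSign x.2.1 x.2.2 m y.2.1 y.2.2 : ℂ) • ∑ c, w m c • thirdPartial x.1 y.1 c) ∘ₗ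
    Submodule.subtype _

theorem koszulEntry_apply (w : Fin 5 → σ → ℂ) (x y : σ × Fin 5 × Fin 5)
    (T : homogeneousSubmodule σ ℂ 3) :
    koszulEntry w x y T =
      ∑ m, (altSign x.2.1 x.2.2 m y.2.1 y.2.2 : ℂ) * ∑ c, w m c * thirdPartial x.1 y.1 c T := by
  simp [koszulEntry]

theorem koszulEntry_linPow (w : Fin 5 → σ → ℂ) (x y : σ × Fin 5 × Fin 5) (v : σ → ℂ) :
    koszulEntry w x y (linPow 3 v) = v y.1 *
      (6 * v x.1 * ∑ m, (altSign x.2.1 x.2.2 m y.2.1 y.2.2 : ℂ) * ∑ c, w m c * v c) := by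
  simp only [koszulEntry_apply, linPow, thirdPartial_linForm_pow, Finset.mul_sum]
  exact Finset.sum_congr rfl fun m _ => Finset.sum_congr rfl fun c _ => by ring

/-- Column `(b, k, l)` is `v b` times a vector `c k l` that alternates in `k, l` and is annihilated
by the image `u` of `v`. -/
theorem rank_koszulEntry_linPow_le {n : Type*} [Fintype n] (w : Fin 5 → σ → ℂ)
    (f g : n → σ × Fin 5 × Fin 5) (v : σ → ℂ) :
    (Matrix.of fun i j => koszulEntry w (f i) (g j) (linPow 3 v)).rank ≤ 6 := by
  let u : Fin 5 → ℂ := fun m => ∑ c, w m c * v c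
  let c : Fin 5 → Fin 5 → n → ℂ := fun k l i =>
    6 * v (f i).1 * ∑ m, (altSign (f i).2.1 (f i).2.2 m k l : ℂ) * u m
  have hentry : ∀ i j, koszulEntry w (f i) (g j) (linPow 3 v) =
      v (g j).1 * c (g j).2.1 (g j).2.2 i := fun i j => koszulEntry_linPow w (f i) (g j) v
  by_cases hu : u = 0
  · have : (Matrix.of fun i j => koszulEntry w (f i) (g j) (linPow 3 v)) = 0 := by
      ext i j
      simp [hentry, c, hu]
    simp [this]
  have hc : ∀ k l, c l k = -c k l := by
    intro k l
    ext i
    simp only [c, Pi.neg_apply, fun i j m => altSign_swap_snd i j m k l]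
    simp
  have hrel : ∀ l, ∑ k, u k • c k l = 0 := by
    intro l
    ext i
    simp only [c, Finset.sum_apply, Pi.smul_apply, smul_eq_mul, Pi.zero_apply]
    have : ∑ k, u k * ∑ m, (altSign (f i).2.1 (f i).2.2 m k l : ℂ) * u m = 0 := by
      -- `u k * u m` is symmetric and the sign is antisymmetric in `k, m`, so exchanging them
      -- negates the sum.
      refine self_eq_neg.1 ?_
      simp only [Finset.mul_sum, ← Finset.sum_neg_distrib]
      rw [Finset.sum_comm]
      refine Finset.sum_congr rfl fun k _ => Finset.sum_congr rfl fun m _ => ?_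
      rw [altSign_swap_mid]
      push_cast
      ring
    rw [← mul_zero (6 * v (f i).1), ← this, Finset.mul_sum]
    exact Finset.sum_congr rfl fun k _ => by ring
  rw [Matrix.rank_eq_finrank_span_cols]
  refine le_trans (Submodule.finrank_mono ?_) (finrank_span_range_le_six c hc u hu hrel)
  rw [Submodule.span_le]
  rintro _ ⟨j, rfl⟩
  have : (Matrix.of fun i j => koszulEntry w (f i) (g j) (linPow 3 v)).col j =
      v (g j).1 • c (g j).2.1 (g j).2.2 := by
    ext i
    simp [hentry]
  rw [this]
  exact Submodule.smul_mem _ _ (Submodule.subset_span ⟨(g j).2, rfl⟩)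

end Koszul

/-! ### The triangular minor for the determinant and the permanent. -/

section DetPerm

/-- The cubic which is the permanent for `s = 1` and the determinant for `s = -1`. -/
noncomputable def signedCubic (s : ℤ) : MvPolynomial (Fin 3 × Fin 3) ℂ :=
  X (0, 0) * X (1, 1) * X (2, 2) + X (0, 1) * X (1, 2) * X (2, 0) +
    X (0, 2) * X (1, 0) * X (2, 1) + C (s : ℂ) * (X (0, 0) * X (1, 2) * X (2, 1)) +
    C (s : ℂ) * (X (0, 1) * X (1, 0) * X (2, 2)) + C (s : ℂ) * (X (0, 2) * X (1, 1) * X (2, 0))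

theorem coe_detForm_three : (detForm 3 : MvPolynomial (Fin 3 × Fin 3) ℂ) = signedCubic (-1) := by
  simp only [detForm, signedCubic, Matrix.det_fin_three, Matrix.mvPolynomialX_apply]
  simp only [Int.cast_neg, Int.cast_one, C_neg, C_1]
  ring

theorem coe_permForm_three : (permForm 3 : MvPolynomial (Fin 3 × Fin 3) ℂ) = signedCubic 1 := by
  simp only [permForm, signedCubic, Matrix.permanent, Matrix.mvPolynomialX_apply]
  rw [show (Finset.univ : Finset (Equiv.Perm (Fin 3))) =
    {1, Equiv.swap 0 1, Equiv.swap 0 2, Equiv.swap 1 2, Equiv.swap 0 1 * Equiv.swap 1 2,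
      Equiv.swap 1 2 * Equiv.swap 0 1} by decide]
  repeat rw [Finset.sum_insert (by decide)]
  simp [Fin.prod_univ_three, Equiv.swap_apply_def]
  ring

theorem signedCubic_mem_closure (s : ℤ) : signedCubic s ∈
    AddSubmonoid.closure (Set.range fun v : Fin 3 × Fin 3 → ℂ => linForm v ^ 3) := by
  have h : ∀ p q r : Fin 3 × Fin 3, X p * X q * X r ∈
      AddSubmonoid.closure (Set.range fun v : Fin 3 × Fin 3 → ℂ => linForm v ^ 3) := fun p q r => by
    simpa using C_mul_X_mul_X_mul_X_mem_closure 1 p q r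
  have hs := C_mul_X_mul_X_mul_X_mem_closure (σ := Fin 3 × Fin 3) (s : ℂ)
  exact add_mem (add_mem (add_mem (add_mem (add_mem (h _ _ _) (h _ _ _)) (h _ _ _)) (hs _ _ _))
    (hs _ _ _)) (hs _ _ _)

/-- The third-order partial derivatives of `signedCubic s`. -/
def cubicPartial (s : ℤ) (a b c : Fin 3 × Fin 3) : ℤ :=
  let μ := monomialPartial a b c
  μ (0, 0) (1, 1) (2, 2) + μ (0, 1) (1, 2) (2, 0) + μ (0, 2) (1, 0) (2, 1) +
    s * μ (0, 0) (1, 2) (2, 1) + s * μ (0, 1) (1, 0) (2, 2) + s * μ (0, 2) (1, 1) (2, 0)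

theorem thirdPartial_signedCubic (s : ℤ) (a b c : Fin 3 × Fin 3) :
    thirdPartial a b c (signedCubic s) = cubicPartial s a b c := by
  simp only [signedCubic, cubicPartial, C_mul', map_add, map_smul, thirdPartial_X_mul_X_mul_X,
    smul_eq_mul]
  push_cast
  ring

/-- A partition of seven of the nine matrix positions into five classes. -/
def positionClass : Fin 3 × Fin 3 → Option (Fin 5)
  | (1, 2) => some 0
  | (2, 2) => some 1
  | (0, 1) => some 2
  | (0, 2) | (1, 0) => some 3
  | (0, 0) | (2, 1) => some 4
  | _ => none

/-- The indicator vectors of the classes of `positionClass`. -/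
def classVector (m : Fin 5) (c : Fin 3 × Fin 3) : ℤ :=
  if positionClass c = some m then 1 else 0

/-- The Hessian of `signedCubic s` in the direction `classVector m`. -/
def classHessian (s : ℤ) (m : Fin 5) (a b : Fin 3 × Fin 3) : ℤ :=
  ∑ c, classVector m c * cubicPartial s a b c

/-- The support of `classHessian`: the position that completes `a` and `b` to a transversal exists
and lies in the class `m`. -/
def classSupport (m : Fin 5) (a b : Fin 3 × Fin 3) : Bool :=
  a.1 ≠ b.1 && a.2 ≠ b.2 && positionClass (-(a.1 + b.1), -(a.2 + b.2)) = some m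

/-- At most one position completes `a, b` to a transversal, so no cancellation can occur and the
support does not depend on the sign. Its coordinates are negated sums because `0 + 1 + 2 = 0` in
`Fin 3`. -/
theorem classHessian_ne_zero_iff {s : ℤ} (hs : s = 1 ∨ s = -1) :
    ∀ m a b, classHessian s m a b ≠ 0 ↔ classSupport m a b := by
  rcases hs with rfl | rfl <;> decide +kernel

/-- The index completing four distinct indices to the whole of `Fin 5`, if they are distinct. -/
def fifthIndex (i j k l : Fin 5) : Option (Fin 5) :=
  if i ≠ j ∧ i ≠ k ∧ i ≠ l ∧ j ≠ k ∧ j ≠ l ∧ k ≠ l then some (-(i + j + k + l)) else none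

/-- The elements of `Fin 5` sum to zero, so the missing index is minus the sum of the other four. -/
theorem altSign_ne_zero_iff :
    ∀ i j m k l, altSign i j m k l ≠ 0 ↔ fifthIndex i j k l = some m := by
  decide +kernel

/-- The entries of the Koszul flattening of `signedCubic s` along the class vectors. -/
def cubicKoszul (s : ℤ) (x y : (Fin 3 × Fin 3) × Fin 5 × Fin 5) : ℤ :=
  ∑ m, altSign x.2.1 x.2.2 m y.2.1 y.2.2 * classHessian s m x.1 y.1

/-- The support of `cubicKoszul`. -/
def koszulSupport (x y : (Fin 3 × Fin 3) × Fin 5 × Fin 5) : Bool :=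
  match fifthIndex x.2.1 x.2.2 y.2.1 y.2.2 with
  | none => false
  | some m => classSupport m x.1 y.1

theorem cubicKoszul_ne_zero_iff {s : ℤ} (hs : s = 1 ∨ s = -1)
    (x y : (Fin 3 × Fin 3) × Fin 5 × Fin 5) : cubicKoszul s x y ≠ 0 ↔ koszulSupport x y := by
  unfold cubicKoszul koszulSupport
  have h := fun m => altSign_ne_zero_iff x.2.1 x.2.2 m y.2.1 y.2.2
  cases hf : fifthIndex x.2.1 x.2.2 y.2.1 y.2.2 with
  | none =>
    simp only [hf, reduceCtorEq, iff_false, not_not] at h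
    simp [h]
  | some m =>
    rw [Finset.sum_eq_single m]
    · have := (h m).2 hf
      simp [← classHessian_ne_zero_iff hs, this]
    · intro m' _ hm'
      have : altSign x.2.1 x.2.2 m' y.2.1 y.2.2 = 0 := by
        by_contra h0
        exact hm' (Option.some_injective _ (((h m').1 h0).symm.trans hf))
      rw [this, zero_mul]
    · simp

theorem koszulEntry_eq_cubicKoszul {s : ℤ} {P : homogeneousSubmodule (Fin 3 × Fin 3) ℂ 3}
    (hP : (P : MvPolynomial (Fin 3 × Fin 3) ℂ) = signedCubic s)
    (x y : (Fin 3 × Fin 3) × Fin 5 × Fin 5) :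
    koszulEntry (fun m c => (classVector m c : ℂ)) x y P = cubicKoszul s x y := by
  rw [koszulEntry_apply, hP]
  simp only [thirdPartial_signedCubic, cubicKoszul, classHessian]
  push_cast
  rfl

/-- Row and column indices of a triangular submatrix of the Koszul flattening. -/
def koszulPivots : List (((Fin 3 × Fin 3) × Fin 5 × Fin 5) × ((Fin 3 × Fin 3) × Fin 5 × Fin 5)) :=
  [(((0, 0), 0, 1), ((1, 2), 2, 3)), (((0, 0), 0, 2), ((1, 1), 3, 4)),
   (((0, 0), 0, 4), ((1, 1), 2, 3)), (((0, 0), 1, 4), ((2, 1), 2, 3)),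
   (((0, 0), 2, 4), ((1, 1), 0, 3)), (((0, 1), 0, 1), ((2, 2), 2, 4)),
   (((0, 1), 0, 2), ((1, 0), 3, 4)), (((0, 1), 0, 3), ((1, 0), 2, 4)),
   (((0, 1), 0, 4), ((1, 0), 2, 3)), (((0, 1), 1, 3), ((2, 0), 2, 4)),
   (((0, 2), 0, 1), ((2, 1), 2, 4)), (((0, 0), 1, 3), ((1, 2), 0, 2)),
   (((0, 2), 0, 2), ((1, 0), 1, 3)), (((0, 2), 0, 3), ((1, 0), 1, 2)),
   (((0, 2), 0, 4), ((2, 1), 1, 2)), (((0, 0), 3, 4), ((1, 1), 0, 2)),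
   (((0, 2), 1, 3), ((1, 0), 0, 2)), (((0, 1), 3, 4), ((2, 0), 1, 2)),
   (((0, 2), 1, 4), ((2, 1), 0, 2)), (((0, 2), 2, 3), ((1, 0), 0, 1)),
   (((0, 2), 2, 4), ((2, 1), 0, 1)), (((1, 0), 0, 1), ((0, 2), 2, 3)),
   (((1, 0), 0, 4), ((0, 1), 2, 3)), (((1, 0), 1, 4), ((2, 2), 0, 3)),
   (((1, 0), 2, 4), ((0, 1), 0, 3)), (((1, 0), 3, 4), ((0, 1), 0, 2)),
   (((1, 1), 0, 1), ((2, 2), 2, 3)), (((1, 1), 0, 3), ((0, 0), 2, 4)),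
   (((1, 1), 0, 4), ((0, 0), 2, 3)), (((1, 1), 1, 2), ((2, 0), 0, 4)),
   (((1, 1), 1, 3), ((2, 2), 0, 2)), (((0, 1), 1, 4), ((2, 0), 2, 3)),
   (((1, 1), 1, 4), ((2, 0), 0, 2)), (((1, 1), 2, 3), ((0, 0), 0, 4)),
   (((1, 1), 3, 4), ((0, 0), 0, 2)), (((1, 2), 0, 1), ((2, 0), 3, 4)),
   (((0, 1), 1, 2), ((2, 2), 0, 4)), (((1, 0), 1, 3), ((0, 2), 0, 2)),
   (((1, 2), 0, 2), ((0, 0), 1, 3)), (((1, 2), 0, 4), ((2, 0), 1, 3)),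
   (((0, 1), 2, 4), ((1, 0), 0, 3)), (((0, 2), 1, 2), ((2, 1), 0, 4)),
   (((1, 0), 1, 2), ((0, 2), 0, 3)), (((1, 2), 1, 4), ((2, 0), 0, 3)),
   (((1, 2), 2, 3), ((0, 0), 0, 1)), (((1, 2), 3, 4), ((2, 0), 0, 1)),
   (((1, 1), 2, 4), ((0, 0), 0, 3)), (((1, 2), 1, 2), ((2, 1), 0, 3)),
   (((2, 0), 0, 2), ((1, 1), 1, 4)), (((2, 0), 0, 3), ((1, 2), 1, 4)),
   (((2, 0), 0, 4), ((1, 1), 1, 2)), (((2, 0), 1, 4), ((1, 2), 0, 3)),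
   (((0, 0), 1, 2), ((2, 1), 3, 4)), (((2, 0), 2, 3), ((0, 1), 1, 4)),
   (((2, 1), 0, 1), ((0, 2), 2, 4)), (((2, 1), 0, 3), ((1, 2), 1, 2)),
   (((0, 0), 0, 3), ((1, 1), 2, 4)), (((2, 0), 0, 1), ((1, 2), 3, 4)),
   (((2, 1), 0, 4), ((0, 2), 1, 2)), (((1, 0), 0, 3), ((0, 1), 2, 4)),
   (((2, 0), 1, 3), ((1, 2), 0, 4)), (((2, 1), 2, 4), ((0, 2), 0, 1)),
   (((1, 0), 2, 3), ((0, 1), 0, 4)), (((2, 1), 3, 4), ((0, 0), 1, 2)),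
   (((1, 2), 0, 3), ((2, 0), 1, 4)), (((0, 1), 2, 3), ((1, 0), 0, 4)),
   (((1, 1), 0, 2), ((0, 0), 3, 4)), (((2, 1), 1, 2), ((0, 2), 0, 4)),
   (((2, 2), 0, 2), ((1, 1), 1, 3)), (((2, 2), 0, 3), ((1, 0), 1, 4)),
   (((2, 1), 0, 2), ((0, 2), 1, 4)), (((2, 2), 0, 4), ((0, 1), 1, 2)),
   (((2, 0), 3, 4), ((1, 2), 0, 1)), (((0, 0), 2, 3), ((1, 1), 0, 4)),
   (((2, 0), 1, 2), ((0, 1), 3, 4)), (((1, 0), 0, 2), ((0, 2), 1, 3)),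
   (((2, 1), 2, 3), ((0, 0), 1, 4)), (((2, 2), 2, 3), ((1, 1), 0, 1)),
   (((2, 0), 2, 4), ((0, 1), 1, 3)), (((2, 2), 2, 4), ((0, 1), 0, 1))]

theorem koszulSupport_pivot : ∀ p ∈ koszulPivots, koszulSupport p.1 p.2 := by
  decide +kernel

/-- The order of the list matters: each row vanishes at all later columns, which makes the minor
lower triangular. -/
theorem koszulPivots_pairwise :
    koszulPivots.Pairwise fun p q => koszulSupport p.1 q.2 = false := by
  decide +kernel

theorem fourteen_le_symBorderRank {s : ℤ} (hs : s = 1 ∨ s = -1)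
    {P : homogeneousSubmodule (Fin 3 × Fin 3) ℂ 3}
    (hP : (P : MvPolynomial (Fin 3 × Fin 3) ℂ) = signedCubic s) : 14 ≤ symBorderRank P := by
  have hlen : koszulPivots.length = 80 := rfl
  let p : Fin koszulPivots.length → _ := koszulPivots.get
  have h := card_le_symBorderRank_mul
    (fun i j => koszulEntry (fun m c => (classVector m c : ℂ)) (p i).1 (p j).2) 6
    (rank_koszulEntry_linPow_le _ (fun i => (p i).1) (fun j => (p j).2)) (P := P) ?_
    (exists_isSumOfPowers_iff.2 (hP ▸ signedCubic_mem_closure s))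
  -- `80 ≤ 6 r` excludes `r ≤ 13`, since `6 * 13 = 78`.
  · rw [Fintype.card_fin, hlen] at h
    omega
  · simp only [koszulEntry_eq_cubicKoszul hP]
    rw [Matrix.det_of_isLowerTriangular, Finset.prod_ne_zero_iff]
    · intro i _
      simpa using (cubicKoszul_ne_zero_iff hs _ _).2
        (koszulSupport_pivot (p i) (koszulPivots.get_mem i))
    · intro i j hij
      have hij' : i < j := hij
      have h0 := List.pairwise_iff_get.1 koszulPivots_pairwise i j hij'
      by_contra hne
      have hne' : cubicKoszul s (p i).1 (p j).2 ≠ 0 := by simpa using hne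
      rw [cubicKoszul_ne_zero_iff hs] at hne'
      exact Bool.false_ne_true (h0.symm.trans hne')

end DetPerm

theorem theorem1p8 : 14 ≤ symBorderRank (detForm 3) ∧ 14 ≤ symBorderRank (permForm 3) :=
  ⟨fourteen_le_symBorderRank (Or.inr rfl) coe_detForm_three,
    fourteen_le_symBorderRank (Or.inl rfl) coe_permForm_three⟩
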